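/- **Theorem (Dupont 2-Puppe-exact implies weakly Puppe 2-exact).** Let $\mathcal L$ be a strictly described $\mathrm{Gpd}^*$-category, that is, a strict 2-category all of whose 2-cells are invertible, with a zero morphism $0_{A,B}\colon A\to B$ for all objects $A,B$ such that $f\circ 0=0$, $0\circ f=0$ for all morphisms $f$, and such that whiskering any 2-cell with a zero morphism gives an identity 2-cell. *(a)* If $\mathcal L$ is 2-Puppe-exact in the sense of Dupont, then $\mathcal L$ is weakly Puppe 2-exact (it is 2-pointed, and it is weakly Puppe 2-exact for every choice of a bizero object). *(b)* Hence, if $\mathcal L$ is 2-abelian, then $\mathcal L$ is weakly Puppe 2-exact (in the same sense). *Dupont's notions.* A *zero object* is an object $Z$ such that all $\mathcal L(A,Z)$ and $\mathcal L(Z,A)$ are equivalent to the terminal category. A *2-kernel* of $f\colon A\to B$ is a pair $(k\colon K\to A,\ \kappa\colon fk\Rightarrow 0)$ such that (1) for all $z\colon X\to A$ and $\beta\colon fz\Rightarrow 0$ there are $u\colon X\to K$ and $\gamma\colon z\Rightarrow ku$ with $\kappa u\cdot f\gamma=\beta$; (2) for all $x,y\colon X\to K$ and $\lambda\colon kx\Rightarrow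 ky$ with $\kappa y\cdot f\lambda=\kappa x$ there is a unique $\mu\colon x\Rightarrow y$ with $k\mu=\lambda$. A morphism $f\colon A\to B$ is *0-faithful* if every $\pi\colon 0\Rightarrow 0\colon X\to A$ with $f\pi=1$ is an identity; it is *fully 0-faithful* if for all $a\colon X\to A$ and $\beta\colon fa\Rightarrow 0$ there is a unique $\alpha\colon a\Rightarrow 0$ with $f\alpha=\beta$. A *copip* of $f$ is a loop $\rho\colon 0\Rightarrow 0\colon B\to P$ with $\rho f=1$ such that every loop $\theta\colon 0\Rightarrow 0\colon B\to X$ with $\theta f=1$ is $a\rho$ for some $a\colon P\to X$, and for all $a,b\colon P\to X$ with $a\rho=b\rho$ there is exactly one 2-cell $a\Rightarrow b$. A *root* of a loop $\rho\colon 0\Rightarrow 0\colon B\to D$ is a morphism $r\colon R\to B$ with $\rho r=1$ such that every $x\colon X\to B$ with $\rho x=1$ is isomorphic to $ry$ for some $y$, and every 2-cell $rx\Rightarrow ry$ is $r\mu$ for a unique $\mu\colon x\Rightarrow y$. 2-cokernels, 0-cofaithful and fully 0-cofaithful morphisms, pips and coroots are the dual notions. $\mathcal L$ is *2-Puppe-exact*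 if it has a zero object, all 2-kernels and all 2-cokernels, every 0-faithful morphism is (with the given structure 2-cell) a 2-kernel of its 2-cokernel, every 0-cofaithful morphism is a 2-cokernel of its 2-kernel, every fully 0-faithful morphism is a root of its copip and every fully 0-cofaithful morphism is a coroot of its pip. It is *2-abelian* if moreover it has all finite (bicategorical) products and coproducts. *Weak Puppe 2-exactness.* A 2-category is *2-pointed* if it has a *bizero object* $0$: all hom-categories into and out of $0$ are equivalent to the terminal category. Fix such a $0$. A *null morphism* $A\to B$ is a morphism together with a factorization $A\xrightarrow{t}0\xrightarrow{i}B$; the *null 2-cell* from $(t,i)$ to $(t',i')$ is the horizontal composite of the unique 2-cells $t\Rightarrow t'$ and $i\Rightarrow i'$ (it is invertible). A *$(0)$-2-kernel* of $f\colon A\to B$ is a morphism $k\colon K\to A$ with an invertible 2-cell $\alpha\colon fk\Rightarrow n$, $n$ null, such that (1) for every $z\colon Z\to A$ and invertible $\beta\colon fz\Rightarrow m$ with $m$ null there are $u\colon Z\to K$ and an invertible $\gamma\colon z\Rightarrow ku$ such that $\alpha u\cdot f\gamma\cdot\beta^{-1}\colon m\Rightarrow nu$ is null; (2) for all $x,y\colon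 Z\to K$ and $\lambda\colon kx\Rightarrow ky$ such that $\alpha y\cdot f\lambda\cdot\alpha^{-1}x$ is null there is a unique $\mu\colon x\Rightarrow y$ with $k\mu=\lambda$. $(0)$-2-cokernels are dual. The 2-category is *weakly Puppe 2-exact* (for $0$) if 1. all $(0)$-2-kernels and $(0)$-2-cokernels exist; 2. $(0)$ is weakly closed, that is, every $(0)$-2-kernel reflects null 2-cells (if $\mu$ is a 2-cell between null morphisms and $k\mu$ is null, then $\mu$ is null) and weakly reflects null morphisms (if $k$ is a $(0)$-2-kernel of $f$ with structure 2-cell $\alpha$ and $\delta\colon ks\Rightarrow m$ is invertible with $m$ null and $\alpha s\cdot f\delta^{-1}$ null, then there are a null morphism $p$ and an invertible $\psi\colon s\Rightarrow p$ such that $k\psi\cdot\delta^{-1}$ is null), and dually for $(0)$-2-cokernels; 3. every $(0)$-2-kernel is, with the given structure 2-cell, a $(0)$-2-kernel of its $(0)$-2-cokernel, and every $(0)$-2-cokernel is a $(0)$-2-cokernel of its $(0)$-2-kernel; 4. every morphism is isomorphic to a $(0)$-2-cokernel followed by a $(0)$-2-kernel. -/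

import Mathlib

open CategoryTheory Bicategory

universe w v u

namespace TwoExact

/-! ## 2-ideals, 2-kernels and 2-cokernels

Composition is written in diagrammatic order, so `f ≫ g` is "`g` after `f`".  A 2-category is a
strict bicategory; the associators and unitors that appear below are then identities. -/

/-- A 2-ideal of null morphisms and null 2-cells in a 2-category.  `Null A B` is the category of null
morphisms from `A` to `B` and null 2-cells between them, and the faithful functor `ι` sends them to
the underlying morphisms and 2-cells.  A null morphism is thus an underlying morphism together with
a witness of its being null; the witness of `(0)` is a factorization through the zero object.  (If
`ι` is injective on objects, the witness is redundant; the notions below do not use injectivity.)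
`tr a b n` is the null morphism that replaces `a ≫ n ≫ b`, and `ν a b n` is the comparison. -/
structure TwoIdeal (C : Type u) [Bicategory.{w, v} C] [Bicategory.Strict C] where
  Null : C → C → Type v
  [cat : ∀ A B : C, Category.{w} (Null A B)]
  ι : ∀ {A B : C}, Null A B ⥤ (A ⟶ B)
  [faithful : ∀ A B : C, (ι (A := A) (B := B)).Faithful]
  tr : ∀ {A' A B B' : C} (_a : A' ⟶ A) (_b : B ⟶ B') (_n : Null A B), Null A' B'
  ν : ∀ {A' A B B' : C} (a : A' ⟶ A) (b : B ⟶ B') (n : Null A B),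
    a ≫ ι.obj n ≫ b ≅ ι.obj (tr a b n)
  tr_id : ∀ {A B : C} (n : Null A B), tr (𝟙 A) (𝟙 B) n = n
  ν_id : ∀ {A B : C} (n : Null A B), (ν (𝟙 A) (𝟙 B) n).hom =
    eqToHom (by rw [tr_id, Bicategory.Strict.id_comp, Bicategory.Strict.comp_id])
  null_whisker : ∀ {A' A B B' : C} (a : A' ⟶ A) (b : B ⟶ B') {n n' : Null A B} (μ : n ⟶ n'),
    ∃ ξ : tr a b n ⟶ tr a b n',
      ι.map ξ = (ν a b n).inv ≫ a ◁ (ι.map μ ▷ b) ≫ (ν a b n').hom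
  null_two : ∀ {A' A B B' : C} {a a' : A' ⟶ A} {b b' : B ⟶ B'} (α : a ⟶ a') (β : b ⟶ b')
    (n : Null A B), ∃ ξ : tr a b n ⟶ tr a' b' n,
      ι.map ξ = (ν a b n).inv ≫ (α ▷ (ι.obj n ≫ b) ≫ a' ◁ (ι.obj n ◁ β)) ≫ (ν a' b' n).hom
  null_assoc : ∀ {A'' A' A B B' B'' : C} (a' : A'' ⟶ A') (a : A' ⟶ A) (b : B ⟶ B') (b' : B' ⟶ B'')
    (n : Null A B), ∃ ξ : tr a' b' (tr a b n) ≅ tr (a' ≫ a) (b ≫ b') n,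
      ι.map ξ.hom = (ν a' b' (tr a b n)).inv ≫ a' ◁ ((ν a b n).inv ▷ b') ≫
        a' ◁ ((α_ a (ι.obj n ≫ b) b').hom ≫ a ◁ (α_ (ι.obj n) b b').hom) ≫
        (α_ a' a (ι.obj n ≫ b ≫ b')).inv ≫ (ν (a' ≫ a) (b ≫ b') n).hom

attribute [instance] TwoIdeal.cat TwoIdeal.faithful

namespace TwoIdeal

variable {C : Type u} [Bicategory.{w, v} C] [Bicategory.Strict C] (N : TwoIdeal C)

/-- A 2-cell between null morphisms is a null 2-cell. -/
def IsNull {A B : C} {n n' : N.Null A B} (η : N.ι.obj n ⟶ N.ι.obj n') : Prop :=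
  ∃ μ : n ⟶ n', N.ι.map μ = η

/-- A 2-cell between null morphisms is an invertible null 2-cell. -/
def IsNullIso {A B : C} {n n' : N.Null A B} (η : N.ι.obj n ⟶ N.ι.obj n') : Prop :=
  ∃ μ : n ≅ n', N.ι.map μ.hom = η

/-- The comparison `ν` for precomposition only. -/
def νl {A' A B : C} (a : A' ⟶ A) (n : N.Null A B) : a ≫ N.ι.obj n ≅ N.ι.obj (N.tr a (𝟙 B) n) :=
  whiskerLeftIso a (ρ_ (N.ι.obj n)).symm ≪≫ N.ν a (𝟙 B) n

/-- The comparison `ν` for postcomposition only. -/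
def νr {A B B' : C} (n : N.Null A B) (b : B ⟶ B') : N.ι.obj n ≫ b ≅ N.ι.obj (N.tr (𝟙 A) b n) :=
  (λ_ (N.ι.obj n ≫ b)).symm ≪≫ N.ν (𝟙 A) b n

/-- `k`, with the invertible structure 2-cell `α` from `k ≫ f` to the null morphism `n`, is a
2-kernel of `f` with respect to `N`. -/
structure IsKernel {A B K : C} (f : A ⟶ B) (k : K ⟶ A) (n : N.Null K B)
    (α : k ≫ f ≅ N.ι.obj n) : Prop where
  lift : ∀ {Z : C} (z : Z ⟶ A) (m : N.Null Z B) (β : z ≫ f ≅ N.ι.obj m),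
    ∃ (u : Z ⟶ K) (γ : z ≅ u ≫ k),
      N.IsNullIso (β.inv ≫ γ.hom ▷ f ≫ (α_ u k f).hom ≫ u ◁ α.hom ≫ (N.νl u n).hom)
  lift₂ : ∀ {Z : C} (x y : Z ⟶ K) (l : x ≫ k ⟶ y ≫ k),
    N.IsNull ((N.νl x n).inv ≫ x ◁ α.inv ≫ (α_ x k f).inv ≫ l ▷ f ≫ (α_ y k f).hom ≫
      y ◁ α.hom ≫ (N.νl y n).hom) →
    ∃! μ : x ⟶ y, μ ▷ k = l

/-- `c`, with the invertible structure 2-cell `α` from `f ≫ c` to the null morphism `n`, is a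
2-cokernel of `f` with respect to `N`. -/
structure IsCokernel {A B Q : C} (f : A ⟶ B) (c : B ⟶ Q) (n : N.Null A Q)
    (α : f ≫ c ≅ N.ι.obj n) : Prop where
  desc : ∀ {Z : C} (z : B ⟶ Z) (m : N.Null A Z) (β : f ≫ z ≅ N.ι.obj m),
    ∃ (u : Q ⟶ Z) (γ : z ≅ c ≫ u),
      N.IsNullIso (β.inv ≫ f ◁ γ.hom ≫ (α_ f c u).inv ≫ α.hom ▷ u ≫ (N.νr n u).hom)
  desc₂ : ∀ {Z : C} (x y : Q ⟶ Z) (l : c ≫ x ⟶ c ≫ y),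
    N.IsNull ((N.νr n x).inv ≫ α.inv ▷ x ≫ (α_ f c x).hom ≫ f ◁ l ≫ (α_ f c y).inv ≫
      α.hom ▷ y ≫ (N.νr n y).hom) →
    ∃! μ : x ⟶ y, c ◁ μ = l

/-- All 2-kernels exist. -/
def HasKernels : Prop :=
  ∀ {A B : C} (f : A ⟶ B), ∃ (K : C) (k : K ⟶ A) (n : N.Null K B) (α : k ≫ f ≅ N.ι.obj n),
    N.IsKernel f k n α

/-- All 2-cokernels exist. -/
def HasCokernels : Prop :=
  ∀ {A B : C} (f : A ⟶ B), ∃ (Q : C) (c : B ⟶ Q) (n : N.Null A Q) (α : f ≫ c ≅ N.ι.obj n),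
    N.IsCokernel f c n α

/-- The morphism `m` is a 2-kernel of some morphism. -/
def IsKernelMorphism {K A : C} (m : K ⟶ A) : Prop :=
  ∃ (B : C) (f : A ⟶ B) (n : N.Null K B) (α : m ≫ f ≅ N.ι.obj n), N.IsKernel f m n α

/-- The morphism `e` is a 2-cokernel of some morphism. -/
def IsCokernelMorphism {B Q : C} (e : B ⟶ Q) : Prop :=
  ∃ (A : C) (f : A ⟶ B) (n : N.Null A Q) (α : f ≫ e ≅ N.ι.obj n), N.IsCokernel f e n α

/-- `k` reflects null 2-cells. -/
def ReflectsNullTwoCells {K A : C} (k : K ⟶ A) : Prop :=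
  ∀ {D : C} (s s' : N.Null D K) (μ : N.ι.obj s ⟶ N.ι.obj s'),
    N.IsNull ((N.νr s k).inv ≫ μ ▷ k ≫ (N.νr s' k).hom) → N.IsNull μ

/-- `c` coreflects null 2-cells. -/
def CoreflectsNullTwoCells {B Q : C} (c : B ⟶ Q) : Prop :=
  ∀ {D : C} (s s' : N.Null Q D) (μ : N.ι.obj s ⟶ N.ι.obj s'),
    N.IsNull ((N.νl c s).inv ≫ c ◁ μ ≫ (N.νl c s').hom) → N.IsNull μ

/-- `k`, presented as a 2-kernel of `f` with structure 2-cell `α`, weakly reflects null morphisms. -/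
def WeaklyReflectsNull {A B K : C} (f : A ⟶ B) (k : K ⟶ A) (n : N.Null K B)
    (α : k ≫ f ≅ N.ι.obj n) : Prop :=
  ∀ {D : C} (s : D ⟶ K) (m : N.Null D A) (δ : s ≫ k ≅ N.ι.obj m),
    N.IsNullIso ((N.νr m f).inv ≫ δ.inv ▷ f ≫ (α_ s k f).hom ≫ s ◁ α.hom ≫ (N.νl s n).hom) →
    ∃ (p : N.Null D K) (ψ : s ≅ N.ι.obj p),
      N.IsNullIso (δ.inv ≫ ψ.hom ▷ k ≫ (N.νr p k).hom)

/-- `c`, presented as a 2-cokernel of `f` with structure 2-cell `α`, weakly coreflects null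
morphisms. -/
def WeaklyCoreflectsNull {A B Q : C} (f : A ⟶ B) (c : B ⟶ Q) (n : N.Null A Q)
    (α : f ≫ c ≅ N.ι.obj n) : Prop :=
  ∀ {D : C} (s : Q ⟶ D) (m : N.Null B D) (δ : c ≫ s ≅ N.ι.obj m),
    N.IsNullIso ((N.νl f m).inv ≫ f ◁ δ.inv ≫ (α_ f c s).inv ≫ α.hom ▷ s ≫ (N.νr n s).hom) →
    ∃ (p : N.Null Q D) (ψ : s ≅ N.ι.obj p),
      N.IsNullIso (δ.inv ≫ c ◁ ψ.hom ≫ (N.νl c p).hom)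

/-- The 2-ideal `N` is weakly closed. -/
structure IsWeaklyClosed : Prop where
  kernel_null : ∀ {A B K : C} (f : A ⟶ B) (k : K ⟶ A) (n : N.Null K B) (α : k ≫ f ≅ N.ι.obj n),
    N.IsKernel f k n α → N.WeaklyReflectsNull f k n α
  kernel_two : ∀ {K A : C} (k : K ⟶ A), N.IsKernelMorphism k → N.ReflectsNullTwoCells k
  cokernel_null : ∀ {A B Q : C} (f : A ⟶ B) (c : B ⟶ Q) (n : N.Null A Q)
    (α : f ≫ c ≅ N.ι.obj n), N.IsCokernel f c n α → N.WeaklyCoreflectsNull f c n α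
  cokernel_two : ∀ {B Q : C} (c : B ⟶ Q), N.IsCokernelMorphism c → N.CoreflectsNullTwoCells c

/-- The 2-category `C` is weakly Grandis 2-exact with respect to the 2-ideal `N`. -/
structure IsWeaklyGrandisExact : Prop where
  hasKernels : N.HasKernels
  hasCokernels : N.HasCokernels
  weaklyClosed : N.IsWeaklyClosed
  kernel_of_cokernel : ∀ {K A Q : C} (m : K ⟶ A), N.IsKernelMorphism m →
    ∀ (c : A ⟶ Q) (n : N.Null K Q) (γ : m ≫ c ≅ N.ι.obj n),
      N.IsCokernel m c n γ → N.IsKernel c m n γ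
  cokernel_of_kernel : ∀ {K A Q : C} (e : A ⟶ Q), N.IsCokernelMorphism e →
    ∀ (k : K ⟶ A) (n : N.Null K Q) (γ : k ≫ e ≅ N.ι.obj n),
      N.IsKernel e k n γ → N.IsCokernel k e n γ
  factorization : ∀ {A B : C} (f : A ⟶ B), ∃ (Q : C) (e : A ⟶ Q) (m : Q ⟶ B),
    N.IsCokernelMorphism e ∧ N.IsKernelMorphism m ∧ Nonempty (f ≅ e ≫ m)

end TwoIdeal

/-! ## The 2-pointed case -/

section Pointed

variable {C : Type u} [Bicategory.{w, v} C]

/-- `Z` is a bizero object: all categories of morphisms into `Z` and out of `Z` are equivalent to the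
terminal category. -/
structure IsBizero (Z : C) : Prop where
  terminal : ∀ A : C, Nonempty ((A ⟶ Z) ≌ Discrete PUnit.{1})
  initial : ∀ A : C, Nonempty ((Z ⟶ A) ≌ Discrete PUnit.{1})

theorem IsBizero.hom_ext_to {Z : C} (hZ : IsBizero Z) {A : C} {s t : A ⟶ Z} (σ τ : s ⟶ t) :
    σ = τ := by
  obtain ⟨e⟩ := hZ.terminal A
  exact e.functor.map_injective (Subsingleton.elim _ _)

theorem IsBizero.hom_ext_from {Z : C} (hZ : IsBizero Z) {A : C} {s t : Z ⟶ A} (σ τ : s ⟶ t) :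
    σ = τ := by
  obtain ⟨e⟩ := hZ.initial A
  exact e.functor.map_injective (Subsingleton.elim _ _)

/-- `C` is 2-pointed. -/
def IsTwoPointed (C : Type u) [Bicategory.{w, v} C] : Prop :=
  ∃ Z : C, IsBizero Z

/-- The composite through `Z`, as a functor: `(t, i)` is sent to `t ≫ i`, and a pair of 2-cells is
sent to its horizontal composite. -/
@[simps]
def throughZero (Z A B : C) : (A ⟶ Z) × (Z ⟶ B) ⥤ (A ⟶ B) where
  obj p := p.1 ≫ p.2
  map {p q} μ := μ.1 ▷ p.2 ≫ q.1 ◁ μ.2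
  map_comp {p q r} μ κ := by
    simp [whisker_exchange_assoc]

variable [Bicategory.Strict C]

/-- The 2-ideal `(0)` of a 2-category with a chosen bizero object `Z`.  A null morphism is a morphism
`t ≫ i` factored through `Z`, and the null 2-cells are the horizontal composites of the (unique)
2-cells between the first factors and between the second factors. -/
def zeroIdeal (Z : C) (hZ : IsBizero Z) : TwoIdeal C where
  Null A B := (A ⟶ Z) × (Z ⟶ B)
  ι {A B} := throughZero Z A B
  faithful A B := ⟨fun _ => Prod.ext (hZ.hom_ext_to _ _) (hZ.hom_ext_from _ _)⟩
  tr a b n := (a ≫ n.1, n.2 ≫ b)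
  ν a b n := whiskerLeftIso a (α_ n.1 n.2 b) ≪≫ (α_ a n.1 (n.2 ≫ b)).symm
  tr_id n := Prod.ext (Bicategory.Strict.id_comp _) (Bicategory.Strict.comp_id _)
  ν_id n := by
    simp [throughZero, Bicategory.Strict.associator_eqToIso]
  null_whisker a b n n' μ := ⟨(a ◁ μ.1, μ.2 ▷ b), by simp [throughZero]⟩
  null_two {_ _ _ _ a a' b b'} α β n := ⟨(α ▷ n.1, n.2 ◁ β), by
    simp [throughZero]⟩
  null_assoc a' a b b' n := ⟨Iso.prod (α_ a' a n.1).symm (α_ n.2 b b'), by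
    simp [throughZero]; bicategory⟩

/-- The 2-category `C`, with the chosen object `Z`, is weakly Puppe 2-exact. -/
def IsWeaklyPuppeExact (Z : C) : Prop :=
  ∃ hZ : IsBizero Z, (zeroIdeal Z hZ).IsWeaklyGrandisExact

end Pointed

/-! ## Categories enriched over pointed groupoids -/

/-- The pointing of the homs of a strictly described category enriched over pointed groupoids (the
underlying (2,1)-category is given by the instances `Bicategory`, `Bicategory.Strict` and
`IsLocallyGroupoid`): a zero morphism in each hom, strictly preserved by composition. -/
class PointedHoms (C : Type u) [Bicategory.{w, v} C] where
  zero : ∀ A B : C, A ⟶ B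
  zero_comp : ∀ (A : C) {B D : C} (f : B ⟶ D), zero A B ≫ f = zero A D
  comp_zero : ∀ {A B : C} (f : A ⟶ B) (D : C), f ≫ zero B D = zero A D
  zero_whisker : ∀ (A : C) {B D : C} {f g : B ⟶ D} (η : f ⟶ g),
    zero A B ◁ η = eqToHom ((zero_comp A f).trans (zero_comp A g).symm)
  whisker_zero : ∀ {A B : C} {f g : A ⟶ B} (η : f ⟶ g) (D : C),
    η ▷ zero B D = eqToHom ((comp_zero f D).trans (comp_zero g D).symm)

namespace Gpd

open PointedHoms

variable {C : Type u} [Bicategory.{w, v} C] [PointedHoms C]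

/-- The loop on the zero morphism `X ⟶ B` obtained by precomposing a loop on `A ⟶ B` with `a`. -/
def pre {X A B : C} (a : X ⟶ A) (π : zero A B ⟶ zero A B) : zero X B ⟶ zero X B :=
  eqToHom (comp_zero a B).symm ≫ a ◁ π ≫ eqToHom (comp_zero a B)

/-- The loop on the zero morphism `A ⟶ Y` obtained by postcomposing a loop on `A ⟶ B` with `b`. -/
def post {A B Y : C} (π : zero A B ⟶ zero A B) (b : B ⟶ Y) : zero A Y ⟶ zero A Y :=
  eqToHom (zero_comp A b).symm ≫ π ▷ b ≫ eqToHom (zero_comp A b)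

/-- `k` with `κ : k ≫ f ⟶ 0` is a 2-kernel of `f`. -/
structure IsKernel {A B K : C} (f : A ⟶ B) (k : K ⟶ A) (κ : k ≫ f ⟶ zero K B) : Prop where
  lift : ∀ {X : C} (z : X ⟶ A) (β : z ≫ f ⟶ zero X B), ∃ (u : X ⟶ K) (γ : z ⟶ u ≫ k),
    γ ▷ f ≫ (α_ u k f).hom ≫ u ◁ κ ≫ eqToHom (comp_zero u B) = β
  lift₂ : ∀ {X : C} (x y : X ⟶ K) (l : x ≫ k ⟶ y ≫ k),
    l ▷ f ≫ (α_ y k f).hom ≫ y ◁ κ ≫ eqToHom (comp_zero y B) =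
      (α_ x k f).hom ≫ x ◁ κ ≫ eqToHom (comp_zero x B) →
    ∃! μ : x ⟶ y, μ ▷ k = l

/-- `c` with `κ : f ≫ c ⟶ 0` is a 2-cokernel of `f`. -/
structure IsCokernel {A B Q : C} (f : A ⟶ B) (c : B ⟶ Q) (κ : f ≫ c ⟶ zero A Q) : Prop where
  desc : ∀ {X : C} (z : B ⟶ X) (β : f ≫ z ⟶ zero A X), ∃ (u : Q ⟶ X) (γ : z ⟶ c ≫ u),
    f ◁ γ ≫ (α_ f c u).inv ≫ κ ▷ u ≫ eqToHom (zero_comp A u) = β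
  desc₂ : ∀ {X : C} (x y : Q ⟶ X) (l : c ≫ x ⟶ c ≫ y),
    f ◁ l ≫ (α_ f c y).inv ≫ κ ▷ y ≫ eqToHom (zero_comp A y) =
      (α_ f c x).inv ≫ κ ▷ x ≫ eqToHom (zero_comp A x) →
    ∃! μ : x ⟶ y, c ◁ μ = l

/-- `f` is 0-faithful. -/
def IsZeroFaithful {A B : C} (f : A ⟶ B) : Prop :=
  ∀ {X : C} (π : zero X A ⟶ zero X A), post π f = 𝟙 _ → π = 𝟙 _

/-- `f` is 0-cofaithful. -/
def IsZeroCofaithful {A B : C} (f : A ⟶ B) : Prop :=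
  ∀ {X : C} (π : zero B X ⟶ zero B X), pre f π = 𝟙 _ → π = 𝟙 _

/-- `f` is fully 0-faithful. -/
def IsFullyZeroFaithful {A B : C} (f : A ⟶ B) : Prop :=
  ∀ {X : C} (a : X ⟶ A) (β : a ≫ f ⟶ zero X B),
    ∃! α : a ⟶ zero X A, α ▷ f ≫ eqToHom (zero_comp X f) = β

/-- `f` is fully 0-cofaithful. -/
def IsFullyZeroCofaithful {A B : C} (f : A ⟶ B) : Prop :=
  ∀ {X : C} (b : B ⟶ X) (β : f ≫ b ⟶ zero A X),
    ∃! α : b ⟶ zero B X, f ◁ α ≫ eqToHom (comp_zero f X) = β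

/-- The loop `π` on the zero morphism `P ⟶ A` is a pip of `f`. -/
structure IsPip {A B P : C} (f : A ⟶ B) (π : zero P A ⟶ zero P A) : Prop where
  condition : post π f = 𝟙 _
  lift : ∀ {X : C} (θ : zero X A ⟶ zero X A), post θ f = 𝟙 _ → ∃ a : X ⟶ P, pre a π = θ
  lift₂ : ∀ {X : C} (a b : X ⟶ P), pre a π = pre b π → Nonempty (Unique (a ⟶ b))

/-- The loop `π` on the zero morphism `B ⟶ P` is a copip of `f`. -/
structure IsCopip {A B P : C} (f : A ⟶ B) (π : zero B P ⟶ zero B P) : Prop where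
  condition : pre f π = 𝟙 _
  desc : ∀ {X : C} (θ : zero B X ⟶ zero B X), pre f θ = 𝟙 _ → ∃ a : P ⟶ X, post π a = θ
  desc₂ : ∀ {X : C} (a b : P ⟶ X), post π a = post π b → Nonempty (Unique (a ⟶ b))

/-- The morphism `r` is a root of the loop `π` on the zero morphism `B ⟶ D`. -/
structure IsRoot {R B D : C} (π : zero B D ⟶ zero B D) (r : R ⟶ B) : Prop where
  condition : pre r π = 𝟙 _
  lift : ∀ {X : C} (x : X ⟶ B), pre x π = 𝟙 _ → ∃ y : X ⟶ R, Nonempty (x ⟶ y ≫ r)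
  lift₂ : ∀ {X : C} (x y : X ⟶ R) (l : x ≫ r ⟶ y ≫ r), ∃! μ : x ⟶ y, μ ▷ r = l

/-- The morphism `q` is a coroot of the loop `π` on the zero morphism `D ⟶ A`. -/
structure IsCoroot {D A Q : C} (π : zero D A ⟶ zero D A) (q : A ⟶ Q) : Prop where
  condition : post π q = 𝟙 _
  desc : ∀ {X : C} (x : A ⟶ X), post π x = 𝟙 _ → ∃ y : Q ⟶ X, Nonempty (x ⟶ q ≫ y)
  desc₂ : ∀ {X : C} (x y : Q ⟶ X) (l : q ≫ x ⟶ q ≫ y), ∃! μ : x ⟶ y, q ◁ μ = l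

/-- 2-Puppe-exactness in the sense of Dupont.  (A zero object is an object `Z` such that all hom
groupoids into and out of `Z` are equivalent to the terminal one.) -/
structure IsTwoPuppeExact (C : Type u) [Bicategory.{w, v} C] [PointedHoms C] : Prop where
  exists_zero : ∃ Z : C, IsBizero Z
  hasKernels : ∀ {A B : C} (f : A ⟶ B), ∃ (K : C) (k : K ⟶ A) (κ : k ≫ f ⟶ zero K B),
    IsKernel f k κ
  hasCokernels : ∀ {A B : C} (f : A ⟶ B), ∃ (Q : C) (c : B ⟶ Q) (κ : f ≫ c ⟶ zero A Q),
    IsCokernel f c κ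
  kernel_of_cokernel : ∀ {A B Q : C} (f : A ⟶ B), IsZeroFaithful f →
    ∀ (c : B ⟶ Q) (κ : f ≫ c ⟶ zero A Q), IsCokernel f c κ → IsKernel c f κ
  cokernel_of_kernel : ∀ {A B K : C} (f : A ⟶ B), IsZeroCofaithful f →
    ∀ (k : K ⟶ A) (κ : k ≫ f ⟶ zero K B), IsKernel f k κ → IsCokernel k f κ
  root_of_copip : ∀ {A B P : C} (f : A ⟶ B), IsFullyZeroFaithful f →
    ∀ π : zero B P ⟶ zero B P, IsCopip f π → IsRoot π f
  coroot_of_pip : ∀ {A B P : C} (f : A ⟶ B), IsFullyZeroCofaithful f →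
    ∀ π : zero P A ⟶ zero P A, IsPip f π → IsCoroot π f

/-- The morphisms `p j` exhibit `P` as a (2-categorical) product of the family `F`. -/
def IsProduct {J : Type} (F : J → C) (P : C) (p : ∀ j, P ⟶ F j) : Prop :=
  ∀ X : C, (Functor.pi' fun j => postcomp X (p j)).IsEquivalence

/-- The morphisms `i j` exhibit `P` as a (2-categorical) coproduct of the family `F`. -/
def IsCoproduct {J : Type} (F : J → C) (P : C) (i : ∀ j, F j ⟶ P) : Prop :=
  ∀ X : C, (Functor.pi' fun j => precomp X (i j)).IsEquivalence

/-- 2-abelianness in the sense of Dupont. -/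
structure IsTwoAbelian (C : Type u) [Bicategory.{w, v} C] [PointedHoms C] : Prop extends
    IsTwoPuppeExact C where
  hasFiniteProducts : ∀ (n : ℕ) (F : Fin n → C), ∃ (P : C) (p : ∀ j, P ⟶ F j), IsProduct F P p
  hasFiniteCoproducts : ∀ (n : ℕ) (F : Fin n → C), ∃ (P : C) (i : ∀ j, F j ⟶ P),
    IsCoproduct F P i

end Gpd

end TwoExact

/-!
The argument has two parts.

*Comparison of the two notions of kernel.* Fix a bizero object `Z`. A null morphism `t ≫ i` through
`Z` has a canonical 2-cell `zeroIdeal.toZero` to the zero morphism, because the 2-cell from `t` to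
the zero morphism into `Z` is unique, and a 2-cell between null morphisms is null exactly when it is
compatible with these canonical 2-cells (`zeroIdeal.isNull_iff`). Hence a 2-cell into a null morphism
and a 2-cell into a zero morphism carry the same information, and 2-kernels and 2-cokernels with
respect to the ideal `(0)` are those of the pointed groupoid enrichment (`zeroIdeal.isKernel_iff`,
`zeroIdeal.isCokernel_iff`). Kernels are faithful on 2-cells, in particular 0-faithful, so the
exactness axioms for 0-faithful and 0-cofaithful morphisms give the normality conditions, and the
2-dimensional universal property gives weak closedness.

*Factorization.* Let `c` be the cokernel of `f`, let `m` be the kernel of `c`, and factor `f` as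
`e ≫ m`. Then `e` is 0-cofaithful, hence a cokernel of its kernel. The proof is the 2-dimensional
form of the classical one for Puppe exact categories, where one shows that a morphism `g` with
`e ≫ g = 0` vanishes by factoring `e` through the kernel of `g`. Here `g` is replaced by a loop `π`
on a zero morphism with `e ◁ π` trivial. The loop `π` is induced by a morphism into the object of
loops, the kernel of `0 ⟶ X`, and the kernel `r` of that morphism is 0-faithful, annihilates `π`,
and `e` factors through it (`Gpd.IsTwoPuppeExact.exists_root`). The composite `r ≫ m` is 0-faithful,
so it is the kernel of its cokernel `h`. The cokernels `c` and `h` factor through each other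
compatibly with the structure 2-cells, so `m` factors through `r ≫ m` over `c`, and `r` has a section
(`Gpd.IsTwoPuppeExact.exists_section`). Since `r` annihilates `π`, the loop `π` is trivial.

The computations use 2-cells into zero morphisms only: these can be whiskered on either side, and
`whiskerRight_whiskerLeftZero`, `whiskerLeft_whiskerRightZero` express that a 2-cell whiskered with a
zero morphism is trivial.
-/

namespace TwoExact

open PointedHoms

/-! ### Morphisms into and out of a bizero object -/

section Bizero

variable {C : Type u} [Bicategory.{w, v} C]

theorem IsBizero.nonempty_hom_to {Z : C} (hZ : IsBizero Z) {A : C}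
    (s t : A ⟶ Z) : Nonempty (s ⟶ t) := by
  obtain ⟨e⟩ := hZ.terminal A
  exact ⟨e.functor.preimage (eqToHom (Subsingleton.elim _ _))⟩

theorem IsBizero.nonempty_hom_from {Z : C} (hZ : IsBizero Z) {A : C}
    (s t : Z ⟶ A) : Nonempty (s ⟶ t) := by
  obtain ⟨e⟩ := hZ.initial A
  exact ⟨e.functor.preimage (eqToHom (Subsingleton.elim _ _))⟩

end Bizero

namespace Gpd

/-! ### Whiskering of 2-cells into a zero morphism -/

section Whiskering

variable {C : Type u} [Bicategory.{w, v} C] [PointedHoms C]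

/-- The 2-cell `x ≫ g ⟶ 0` obtained by whiskering `κ : g ⟶ 0` with `x` on the left. -/
def whiskerLeftZero {X A B : C} (x : X ⟶ A) {g : A ⟶ B} (κ : g ⟶ zero A B) :
    x ≫ g ⟶ zero X B :=
  x ◁ κ ≫ eqToHom (comp_zero x B)

/-- The 2-cell `g ≫ y ⟶ 0` obtained by whiskering `κ : g ⟶ 0` with `y` on the right. -/
def whiskerRightZero {A B Y : C} {g : A ⟶ B} (κ : g ⟶ zero A B) (y : B ⟶ Y) :
    g ≫ y ⟶ zero A Y :=
  κ ▷ y ≫ eqToHom (zero_comp A y)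

/-- Left whiskering of a 2-cell into a zero morphism. -/
infixr:81 " ◁₀ " => whiskerLeftZero

/-- Right whiskering of a 2-cell into a zero morphism. -/
infixl:81 " ▷₀ " => whiskerRightZero

theorem whiskerLeftZero_comp {X A B : C} (x : X ⟶ A) {g g' : A ⟶ B} (η : g ⟶ g')
    (κ : g' ⟶ zero A B) : x ◁₀ (η ≫ κ) = x ◁ η ≫ x ◁₀ κ := by
  simp [whiskerLeftZero]

theorem comp_whiskerRightZero {A B Y : C} {g g' : A ⟶ B} (η : g ⟶ g') (κ : g' ⟶ zero A B)
    (y : B ⟶ Y) : (η ≫ κ) ▷₀ y = η ▷ y ≫ κ ▷₀ y := by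
  simp [whiskerRightZero]

/-- Whiskering a 2-cell with a zero morphism is trivial, so `x ◁₀ κ` depends on `x` only up to
isomorphism. -/
theorem whiskerRight_whiskerLeftZero {X A B : C} {x y : X ⟶ A} (σ : x ⟶ y) {g : A ⟶ B}
    (κ : g ⟶ zero A B) : σ ▷ g ≫ y ◁₀ κ = x ◁₀ κ := by
  rw [whiskerLeftZero, ← whisker_exchange_assoc, whisker_zero, eqToHom_trans, whiskerLeftZero]

theorem whiskerLeft_whiskerRightZero {A B Y : C} {g : A ⟶ B} (κ : g ⟶ zero A B) {x y : B ⟶ Y}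
    (σ : x ⟶ y) : g ◁ σ ≫ κ ▷₀ y = κ ▷₀ x := by
  rw [whiskerRightZero, whisker_exchange_assoc, zero_whisker, eqToHom_trans, whiskerRightZero]

/-- Triviality of a whiskered loop, stated without conjugation by equalities of 1-morphisms. -/
theorem pre_eq_id_iff {X A B : C} (a : X ⟶ A) (π : zero A B ⟶ zero A B) :
    pre a π = 𝟙 _ ↔ a ◁₀ π = a ◁₀ 𝟙 _ := by
  rw [pre, eqToHom_comp_iff, whiskerLeftZero, whiskerLeftZero]
  simp

theorem post_eq_id_iff {A B Y : C} (π : zero A B ⟶ zero A B) (b : B ⟶ Y) :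
    post π b = 𝟙 _ ↔ π ▷₀ b = 𝟙 _ ▷₀ b := by
  rw [post, eqToHom_comp_iff, whiskerRightZero, whiskerRightZero]
  simp

variable [Bicategory.Strict C]

theorem id_whiskerLeftZero {A B : C} {g : A ⟶ B} (κ : g ⟶ zero A B) :
    𝟙 A ◁₀ κ = (λ_ g).hom ≫ κ := by
  simp [whiskerLeftZero, Strict.leftUnitor_eqToIso]

theorem whiskerRightZero_id {A B : C} {g : A ⟶ B} (κ : g ⟶ zero A B) :
    κ ▷₀ 𝟙 B = (ρ_ g).hom ≫ κ := by
  simp [whiskerRightZero, Strict.rightUnitor_eqToIso]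

theorem comp_whiskerLeftZero {X Y A B : C} (x : X ⟶ Y) (y : Y ⟶ A) {g : A ⟶ B}
    (κ : g ⟶ zero A B) : (x ≫ y) ◁₀ κ = (α_ x y g).hom ≫ x ◁₀ y ◁₀ κ := by
  simp [whiskerLeftZero, Strict.associator_eqToIso]

theorem whiskerRightZero_comp {A B X Y : C} {g : A ⟶ B} (κ : g ⟶ zero A B) (x : B ⟶ X)
    (y : X ⟶ Y) : κ ▷₀ (x ≫ y) = (α_ g x y).inv ≫ κ ▷₀ x ▷₀ y := by
  simp [whiskerRightZero, Strict.associator_eqToIso]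

theorem whiskerZero_assoc {X A B Y : C} (x : X ⟶ A) {g : A ⟶ B} (κ : g ⟶ zero A B) (y : B ⟶ Y) :
    (x ◁₀ κ) ▷₀ y = (α_ x g y).hom ≫ x ◁₀ (κ ▷₀ y) := by
  simp [whiskerLeftZero, whiskerRightZero, Strict.associator_eqToIso]

end Whiskering

/-! ### Kernels are 0-faithful, cokernels are 0-cofaithful -/

section Faithful

variable {C : Type u} [Bicategory.{w, v} C] [PointedHoms C]

/-- The definition of 2-kernels in terms of `◁₀`. -/
theorem isKernel_iff {A B K : C} {f : A ⟶ B} {k : K ⟶ A} {κ : k ≫ f ⟶ zero K B} :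
    IsKernel f k κ ↔
      (∀ {X : C} (z : X ⟶ A) (β : z ≫ f ⟶ zero X B), ∃ (u : X ⟶ K) (γ : z ⟶ u ≫ k),
        γ ▷ f ≫ (α_ u k f).hom ≫ u ◁₀ κ = β) ∧
      (∀ {X : C} (x y : X ⟶ K) (l : x ≫ k ⟶ y ≫ k),
        l ▷ f ≫ (α_ y k f).hom ≫ y ◁₀ κ = (α_ x k f).hom ≫ x ◁₀ κ → ∃! μ : x ⟶ y, μ ▷ k = l) :=
  ⟨fun h => ⟨h.1, h.2⟩, fun h => ⟨h.1, h.2⟩⟩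

/-- The definition of 2-cokernels in terms of `▷₀`. -/
theorem isCokernel_iff {A B Q : C} {f : A ⟶ B} {c : B ⟶ Q} {κ : f ≫ c ⟶ zero A Q} :
    IsCokernel f c κ ↔
      (∀ {X : C} (z : B ⟶ X) (β : f ≫ z ⟶ zero A X), ∃ (u : Q ⟶ X) (γ : z ⟶ c ≫ u),
        f ◁ γ ≫ (α_ f c u).inv ≫ κ ▷₀ u = β) ∧
      (∀ {X : C} (x y : Q ⟶ X) (l : c ≫ x ⟶ c ≫ y),
        f ◁ l ≫ (α_ f c y).inv ≫ κ ▷₀ y = (α_ f c x).inv ≫ κ ▷₀ x → ∃! μ : x ⟶ y, c ◁ μ = l) :=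
  ⟨fun h => ⟨h.1, h.2⟩, fun h => ⟨h.1, h.2⟩⟩

/-- Kernels are faithful on all 2-cells. -/
theorem IsKernel.whiskerRight_injective {A B K : C} {f : A ⟶ B} {k : K ⟶ A}
    {κ : k ≫ f ⟶ zero K B} (h : IsKernel f k κ) {X : C} {x y : X ⟶ K} {σ τ : x ⟶ y}
    (H : σ ▷ k = τ ▷ k) : σ = τ := by
  refine ((isKernel_iff.1 h).2 x y (σ ▷ k) ?_).unique rfl H.symm
  rw [associator_naturality_left_assoc, whiskerRight_whiskerLeftZero]

theorem IsCokernel.whiskerLeft_injective {A B Q : C} {f : A ⟶ B} {c : B ⟶ Q}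
    {κ : f ≫ c ⟶ zero A Q} (h : IsCokernel f c κ) {X : C} {x y : Q ⟶ X} {σ τ : x ⟶ y}
    (H : c ◁ σ = c ◁ τ) : σ = τ := by
  refine ((isCokernel_iff.1 h).2 x y (c ◁ σ) ?_).unique rfl H.symm
  rw [associator_inv_naturality_right_assoc, whiskerLeft_whiskerRightZero]

theorem IsKernel.isZeroFaithful {A B K : C} {f : A ⟶ B} {k : K ⟶ A} {κ : k ≫ f ⟶ zero K B}
    (h : IsKernel f k κ) : IsZeroFaithful k := by
  intro X π hπ
  refine h.whiskerRight_injective ?_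
  simpa only [whiskerRightZero, cancel_mono, id_whiskerRight] using (post_eq_id_iff π k).1 hπ

theorem IsCokernel.isZeroCofaithful {A B Q : C} {f : A ⟶ B} {c : B ⟶ Q} {κ : f ≫ c ⟶ zero A Q}
    (h : IsCokernel f c κ) : IsZeroCofaithful c := by
  intro X π hπ
  refine h.whiskerLeft_injective ?_
  simpa only [whiskerLeftZero, cancel_mono, whiskerLeft_id] using (pre_eq_id_iff c π).1 hπ

theorem IsZeroFaithful.comp [Bicategory.Strict C] {A B D : C} {f : A ⟶ B} {g : B ⟶ D}
    (hf : IsZeroFaithful f) (hg : IsZeroFaithful g) : IsZeroFaithful (f ≫ g) := by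
  intro X π hπ
  refine hf π (hg _ ?_)
  rw [post_eq_id_iff, whiskerRightZero_comp, whiskerRightZero_comp, cancel_epi] at hπ
  have h₁ : post π f = eqToHom (zero_comp X f).symm ≫ π ▷₀ f := rfl
  have h₂ : 𝟙 (zero X B) = eqToHom (zero_comp X f).symm ≫ 𝟙 _ ▷₀ f := by simp [whiskerRightZero]
  rw [post_eq_id_iff, h₁, h₂, comp_whiskerRightZero, comp_whiskerRightZero, hπ]

end Faithful

/-! ### Factorization into a 0-cofaithful morphism and a kernel -/

section Factorization

variable {C : Type u} [Bicategory.{w, v} C] [Bicategory.Strict C] [PointedHoms C]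

/-- For every loop `π` on a zero morphism out of `K` there is a 0-faithful morphism `r` into `K`
that annihilates `π`, in that `pre r π` is trivial, and through which every morphism
annihilating `π` factors. It is the kernel of
the morphism `u : K ⟶ P` classifying `π`, where `P` is the object of loops of `X`. -/
theorem IsTwoPuppeExact.exists_root (hC : IsTwoPuppeExact C) {K X : C}
    (π : zero K X ⟶ zero K X) :
    ∃ (R : C) (r : R ⟶ K), IsZeroFaithful r ∧ pre r π = 𝟙 _ ∧
      ∀ {Y : C} (x : Y ⟶ K), pre x π = 𝟙 _ → ∃ y : Y ⟶ R, Nonempty (x ⟶ y ≫ r) := by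
  obtain ⟨Z, hZ⟩ := hC.exists_zero
  obtain ⟨P, o, κ, ho⟩ := hC.hasKernels (zero Z X)
  rw [isKernel_iff] at ho
  -- Since `o ≫ 0` equals the zero morphism, `κ` is a loop on it, the universal loop on a zero
  -- morphism into `X`; thus `π` is induced from `κ` along some `u`.
  obtain ⟨u, γ, hγ⟩ := ho.1 (zero K Z) (eqToHom (comp_zero _ X) ≫ π)
  rw [whisker_zero, Strict.associator_eqToIso, eqToIso.hom, eqToHom_trans_assoc, eq_comm,
    eqToHom_comp_iff, eqToHom_trans_assoc] at hγ
  have hpre {Y : C} (a : Y ⟶ K) : pre a π = 𝟙 _ ↔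
      (a ≫ u) ◁₀ κ = eqToHom ((congrArg _ (comp_zero o X)).trans (comp_zero (a ≫ u) X)) := by
    rw [pre_eq_id_iff, hγ, whiskerLeftZero_comp, comp_whiskerLeftZero, whiskerLeft_eqToHom,
      eqToHom_comp_iff, Strict.associator_eqToIso, eqToIso.hom, eqToHom_comp_iff]
    simp [whiskerLeftZero]
  obtain ⟨R, r, ρ, hr⟩ := hC.hasKernels u
  -- If `x` annihilates `π`, then `x ≫ u` and `0` induce the same loop from `κ`, so the universal
  -- property of `P` gives a 2-cell `x ≫ u ⟶ 0`, and `x` lifts to the kernel `r` of `u`.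
  refine ⟨R, r, hr.isZeroFaithful, ?_, fun {Y} x hx => ?_⟩
  · rw [hpre, ← whiskerRight_whiskerLeftZero ρ]
    simp [whiskerLeftZero, zero_whisker, whisker_zero, Strict.associator_eqToIso]
  · obtain ⟨l⟩ : Nonempty ((x ≫ u) ≫ o ⟶ zero Y P ≫ o) := hZ.nonempty_hom_to _ _
    obtain ⟨μ, -, -⟩ := ho.2 (x ≫ u) (zero Y P) l (by
      rw [(hpre x).1 hx]
      simp [whiskerLeftZero, zero_whisker, whisker_zero, Strict.associator_eqToIso])
    obtain ⟨y, ξ, -⟩ := hr.lift x μ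
    exact ⟨y, ⟨ξ⟩⟩

/-- Comparisons between cokernel data compose. -/
theorem whiskerRightZero_trans {A B Q H D : C} {f : A ⟶ B} {c : B ⟶ Q} (κ : f ≫ c ⟶ zero A Q)
    {h : B ⟶ H} {v : Q ⟶ H} (γ : h ⟶ c ≫ v) (w : H ⟶ D) :
    f ◁ (γ ▷ w ≫ (α_ c v w).hom) ≫ (α_ f c (v ≫ w)).inv ≫ κ ▷₀ (v ≫ w) =
      (α_ f h w).inv ≫ (f ◁ γ ≫ (α_ f c v).inv ≫ κ ▷₀ v) ▷₀ w := by
  simp only [whiskerRightZero_comp, comp_whiskerRightZero]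
  simp

/-- A comparison of kernel data along `l` commutes with a comparison of cokernel data along `δ`. -/
theorem whiskerZero_exchange {A B R H D : C} {f : A ⟶ B} {e : A ⟶ R} {n : R ⟶ B} (l : f ⟶ e ≫ n)
    {h : B ⟶ H} (κ : n ≫ h ⟶ zero R H) {c : B ⟶ D} {w : H ⟶ D} (δ : c ⟶ h ≫ w) :
    l ▷ c ≫ (α_ e n c).hom ≫ e ◁₀ (n ◁ δ ≫ (α_ n h w).inv ≫ κ ▷₀ w) =
      f ◁ δ ≫ (α_ f h w).inv ≫ (l ▷ h ≫ (α_ e n h).hom ≫ e ◁₀ κ) ▷₀ w := by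
  simp only [whiskerLeftZero_comp, comp_whiskerRightZero, whiskerZero_assoc]
  rw [← associator_inv_naturality_left_assoc, whisker_exchange_assoc]
  simp

/-- If `f` factors as `e ≫ m` through the kernel `m` of its cokernel and `e` factors further
through `r`, where `r ≫ m` is 0-faithful, then `r` has a section. -/
theorem IsTwoPuppeExact.exists_section (hC : IsTwoPuppeExact C) {A B Q K R : C} {f : A ⟶ B}
    {c : B ⟶ Q} {κc : f ≫ c ⟶ zero A Q} (hc : IsCokernel f c κc) {m : K ⟶ B}
    {κm : m ≫ c ⟶ zero K Q} (hm : IsKernel c m κm) {e : A ⟶ K} {φ : f ⟶ e ≫ m}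
    (hφ : φ ▷ c ≫ (α_ e m c).hom ≫ e ◁₀ κm = κc) {r : R ⟶ K} (hr : IsZeroFaithful (r ≫ m))
    {e' : A ⟶ R} (ψ : e ⟶ e' ≫ r) : ∃ j : K ⟶ R, Nonempty (𝟙 K ⟶ j ≫ r) := by
  obtain ⟨H, h, κh, hh⟩ := hC.hasCokernels (r ≫ m)
  have hker := hC.kernel_of_cokernel _ hr h κh hh
  rw [isKernel_iff] at hm hker
  rw [isCokernel_iff] at hc hh
  -- The morphisms `v` and `w` compare the cokernels `c` of `f` and `h` of `r ≫ m`.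
  obtain ⟨w, δ, hδ⟩ := hh.1 c ((α_ r m c).hom ≫ r ◁₀ κm)
  let l' : f ⟶ e' ≫ r ≫ m := φ ≫ ψ ▷ m ≫ (α_ e' r m).hom
  have hl' : l' ▷ c ≫ (α_ e' (r ≫ m) c).hom ≫ e' ◁₀ ((α_ r m c).hom ≫ r ◁₀ κm) = κc := by
    rw [← hφ, ← whiskerRight_whiskerLeftZero ψ, comp_whiskerLeftZero, whiskerLeftZero_comp]
    simp [l']
  obtain ⟨v, γ, hγ⟩ := hc.1 h (l' ▷ h ≫ (α_ e' (r ≫ m) h).hom ≫ e' ◁₀ κh)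
  -- The composite comparison `c ⟶ c ≫ v ≫ w` respects the structure 2-cell of the cokernel `c`, so
  -- it is induced by a 2-cell `σ` from the identity to `v ≫ w`.
  obtain ⟨σ, hσ, -⟩ := hc.2 (𝟙 Q) (v ≫ w) ((ρ_ c).hom ≫ δ ≫ γ ▷ w ≫ (α_ c v w).hom) (by
    rw [← hδ, whiskerZero_exchange, ← hγ, ← whiskerRightZero_trans] at hl'
    rw [whiskerLeft_comp, whiskerLeft_comp, Category.assoc, Category.assoc, hl',
      whiskerRightZero_id]
    simp)
  -- `m` annihilates `h`, through `v`, so it factors through the kernel `r ≫ m` of `h`.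
  obtain ⟨j, l, hl⟩ := hker.1 m (m ◁ γ ≫ (α_ m c v).inv ≫ κm ▷₀ v)
  -- The factorization is compatible with `κm` because `v ≫ w` is isomorphic to the identity under
  -- `c`; hence `m` can be cancelled from `l : m ⟶ (j ≫ r) ≫ m`.
  have hlc : l ▷ c ≫ (α_ j (r ≫ m) c).hom ≫ j ◁₀ ((α_ r m c).hom ≫ r ◁₀ κm) = κm := by
    rw [← hδ, whiskerZero_exchange, hl, ← whiskerRightZero_trans]
    rw [← Iso.inv_comp_eq] at hσ
    rw [← whiskerLeft_comp_assoc, ← hσ, whiskerLeft_comp, Category.assoc,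
      associator_inv_naturality_right_assoc, whiskerLeft_whiskerRightZero, whiskerRightZero_id]
    simp
  obtain ⟨μ, -, -⟩ := hm.2 (𝟙 K) (j ≫ r) ((λ_ m).hom ≫ l ≫ (α_ j r m).inv) (by
    rw [whiskerLeftZero_comp] at hlc
    rw [id_whiskerLeftZero, comp_whiskerLeftZero]
    simp [hlc])
  exact ⟨j, ⟨μ⟩⟩

/-- Every morphism is isomorphic to a 0-cofaithful morphism followed by the kernel of its
cokernel. -/
theorem IsTwoPuppeExact.exists_factorization (hC : IsTwoPuppeExact C) {A B : C} (f : A ⟶ B) :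
    ∃ (Q K : C) (c : B ⟶ Q) (m : K ⟶ B) (κ : m ≫ c ⟶ zero K Q) (e : A ⟶ K),
      IsKernel c m κ ∧ IsZeroCofaithful e ∧ Nonempty (f ⟶ e ≫ m) := by
  obtain ⟨Q, c, κc, hc⟩ := hC.hasCokernels f
  obtain ⟨K, m, κm, hm⟩ := hC.hasKernels c
  obtain ⟨e, φ, hφ⟩ := hm.lift f κc
  refine ⟨Q, K, c, m, κm, e, hm, fun {X} π hπ => ?_, ⟨φ⟩⟩
  obtain ⟨R, r, hr, hrπ, hfac⟩ := hC.exists_root π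
  obtain ⟨e', ⟨ψ⟩⟩ := hfac e hπ
  obtain ⟨j, ⟨μ⟩⟩ := hC.exists_section hc hm hφ (hr.comp hm.isZeroFaithful) ψ
  -- `π` is annihilated by `r`, hence by `j ≫ r`, which is isomorphic to the identity.
  rw [pre_eq_id_iff] at hrπ
  have h : 𝟙 K ◁₀ π = 𝟙 K ◁₀ 𝟙 _ := by
    rw [← whiskerRight_whiskerLeftZero μ, ← whiskerRight_whiskerLeftZero μ, comp_whiskerLeftZero,
      comp_whiskerLeftZero, hrπ]
  simpa only [id_whiskerLeftZero, cancel_epi] using h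

end Factorization
end Gpd

open Gpd

/-! ### The ideal of a bizero object -/

section ZeroIdeal

variable {C : Type u} [Bicategory.{w, v} C] [Bicategory.Strict C] {Z : C} (hZ : IsBizero Z)

namespace zeroIdeal

theorem nonempty_iso [IsLocallyGroupoid C] {A B : C} (n n' : (zeroIdeal Z hZ).Null A B) :
    Nonempty (n ≅ n') := by
  obtain ⟨σ⟩ := hZ.nonempty_hom_to n.1 n'.1
  obtain ⟨τ⟩ := hZ.nonempty_hom_from n.2 n'.2
  exact ⟨Iso.prod (asIso σ) (asIso τ)⟩

variable [PointedHoms C]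

/-- The canonical 2-cell from a null morphism `t ≫ i` to the zero morphism, induced by the unique
2-cell from `t` to the zero morphism into the bizero object. -/
noncomputable def toZero {A B : C} (n : (zeroIdeal Z hZ).Null A B) :
    (zeroIdeal Z hZ).ι.obj n ⟶ zero A B :=
  whiskerRightZero (g := n.1) (hZ.nonempty_hom_to n.1 (zero A Z)).some n.2

theorem toZero_eq {A B : C} (n : (zeroIdeal Z hZ).Null A B) (τ : n.1 ⟶ zero A Z) :
    toZero hZ n = τ ▷₀ n.2 := by
  rw [toZero, hZ.hom_ext_to (Nonempty.some _) τ]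

theorem map_toZero {A B : C} {n n' : (zeroIdeal Z hZ).Null A B} (μ : n ⟶ n') :
    (zeroIdeal Z hZ).ι.map μ ≫ toZero hZ n' = toZero hZ n := by
  obtain ⟨τ⟩ := hZ.nonempty_hom_to n'.1 (zero A Z)
  rw [toZero_eq hZ n' τ, toZero_eq hZ n (μ.1 ≫ τ), comp_whiskerRightZero]
  exact (Category.assoc _ _ _).trans (congrArg _ (whiskerLeft_whiskerRightZero τ μ.2))

theorem νl_hom_toZero {X A B : C} (x : X ⟶ A) (n : (zeroIdeal Z hZ).Null A B) :
    ((zeroIdeal Z hZ).νl x n).hom ≫ toZero hZ _ = x ◁₀ toZero hZ n := by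
  obtain ⟨τ⟩ := hZ.nonempty_hom_to n.1 (zero A Z)
  rw [toZero_eq hZ n τ, toZero_eq hZ _ (x ◁₀ τ)]
  have h : (x ◁ (ρ_ (n.1 ≫ n.2)).inv ≫ x ◁ (α_ n.1 n.2 (𝟙 B)).hom ≫
      (α_ x n.1 (n.2 ≫ 𝟙 B)).inv) ≫ (x ◁₀ τ) ▷₀ (n.2 ≫ 𝟙 B) = x ◁₀ (τ ▷₀ n.2) := by
    rw [← whiskerLeft_whiskerRightZero (x ◁₀ τ) (ρ_ n.2).hom, whiskerZero_assoc]
    simp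
  exact h

theorem νr_hom_toZero {A B Y : C} (n : (zeroIdeal Z hZ).Null A B) (y : B ⟶ Y) :
    ((zeroIdeal Z hZ).νr n y).hom ≫ toZero hZ _ = toZero hZ n ▷₀ y := by
  obtain ⟨τ⟩ := hZ.nonempty_hom_to n.1 (zero A Z)
  rw [toZero_eq hZ n τ, toZero_eq hZ _ ((λ_ n.1).hom ≫ τ)]
  have h : ((λ_ ((n.1 ≫ n.2) ≫ y)).inv ≫ 𝟙 A ◁ (α_ n.1 n.2 y).hom ≫
      (α_ (𝟙 A) n.1 (n.2 ≫ y)).inv) ≫ ((λ_ n.1).hom ≫ τ) ▷₀ (n.2 ≫ y) = (τ ▷₀ n.2) ▷₀ y := by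
    rw [comp_whiskerRightZero, whiskerRightZero_comp]
    simp
  exact h

variable [IsLocallyGroupoid C]

/-- The null 2-cells are those compatible with the canonical 2-cells to the zero morphism. -/
theorem isNull_iff {A B : C} {n n' : (zeroIdeal Z hZ).Null A B}
    {η : (zeroIdeal Z hZ).ι.obj n ⟶ (zeroIdeal Z hZ).ι.obj n'} :
    (zeroIdeal Z hZ).IsNull η ↔ η ≫ toZero hZ n' = toZero hZ n := by
  refine ⟨fun ⟨μ, hμ⟩ => hμ ▸ map_toZero hZ μ, fun h => ?_⟩
  obtain ⟨μ⟩ := nonempty_iso hZ n n'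
  exact ⟨μ.hom, (cancel_mono (toZero hZ n')).1 ((map_toZero hZ μ.hom).trans h.symm)⟩

theorem isNullIso_iff {A B : C} {n n' : (zeroIdeal Z hZ).Null A B}
    {η : (zeroIdeal Z hZ).ι.obj n ⟶ (zeroIdeal Z hZ).ι.obj n'} :
    (zeroIdeal Z hZ).IsNullIso η ↔ η ≫ toZero hZ n' = toZero hZ n := by
  refine ⟨fun ⟨μ, hμ⟩ => hμ ▸ map_toZero hZ μ.hom, fun h => ?_⟩
  obtain ⟨μ⟩ := nonempty_iso hZ n n'
  exact ⟨μ, (cancel_mono (toZero hZ n')).1 ((map_toZero hZ μ.hom).trans h.symm)⟩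

/-- Every 2-cell into a zero morphism comes from an isomorphism with a null morphism. -/
theorem exists_iso_toZero {A B : C} {g : A ⟶ B} (κ : g ⟶ zero A B) :
    ∃ (n : (zeroIdeal Z hZ).Null A B) (α : g ≅ (zeroIdeal Z hZ).ι.obj n),
      α.hom ≫ toZero hZ n = κ := by
  let n : (zeroIdeal Z hZ).Null A B := (zero A Z, zero Z B)
  exact ⟨n, asIso (κ ≫ inv (toZero hZ n)), by simp⟩

/-- The 2-kernels with respect to the ideal of a bizero object are the 2-kernels in the sense of
pointed groupoid enrichment. -/
theorem isKernel_iff {A B K : C} {f : A ⟶ B} {k : K ⟶ A} {n : (zeroIdeal Z hZ).Null K B}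
    {α : k ≫ f ≅ (zeroIdeal Z hZ).ι.obj n} :
    (zeroIdeal Z hZ).IsKernel f k n α ↔ Gpd.IsKernel f k (α.hom ≫ toZero hZ n) := by
  have h₂ {X : C} (x y : X ⟶ K) (l : x ≫ k ⟶ y ≫ k) :
      (zeroIdeal Z hZ).IsNull (((zeroIdeal Z hZ).νl x n).inv ≫ x ◁ α.inv ≫ (α_ x k f).inv ≫
        l ▷ f ≫ (α_ y k f).hom ≫ y ◁ α.hom ≫ ((zeroIdeal Z hZ).νl y n).hom) ↔
      l ▷ f ≫ (α_ y k f).hom ≫ y ◁₀ (α.hom ≫ toZero hZ n) =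
        (α_ x k f).hom ≫ x ◁₀ (α.hom ≫ toZero hZ n) := by
    rw [isNull_iff, ← whiskerLeftIso_inv]
    simp only [Category.assoc, νl_hom_toZero, Iso.inv_comp_eq, whiskerLeftZero_comp,
      whiskerLeftIso_hom]
  have h₁ {X : C} (z : X ⟶ A) (m : (zeroIdeal Z hZ).Null X B) (β : z ≫ f ≅ _) (u : X ⟶ K)
      (γ : z ⟶ u ≫ k) : (zeroIdeal Z hZ).IsNullIso (β.inv ≫ γ ▷ f ≫ (α_ u k f).hom ≫
        u ◁ α.hom ≫ ((zeroIdeal Z hZ).νl u n).hom) ↔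
      γ ▷ f ≫ (α_ u k f).hom ≫ u ◁₀ (α.hom ≫ toZero hZ n) = β.hom ≫ toZero hZ m := by
    rw [isNullIso_iff]
    simp only [Category.assoc, νl_hom_toZero, Iso.inv_comp_eq, whiskerLeftZero_comp]
  rw [Gpd.isKernel_iff]
  refine ⟨fun h => ⟨fun {X} z β => ?_, fun x y l hl => h.lift₂ x y l ((h₂ x y l).2 hl)⟩,
    fun h => ⟨fun {X} z m β => ?_, fun x y l hl => h.2 x y l ((h₂ x y l).1 hl)⟩⟩
  · obtain ⟨m, β', rfl⟩ := exists_iso_toZero hZ β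
    obtain ⟨u, γ, hγ⟩ := h.lift z m β'
    exact ⟨u, γ.hom, (h₁ z m β' u γ.hom).1 hγ⟩
  · obtain ⟨u, γ, hγ⟩ := h.1 z (β.hom ≫ toZero hZ m)
    exact ⟨u, asIso γ, (h₁ z m β u γ).2 hγ⟩

/-- The 2-cokernels with respect to the ideal of a bizero object are the 2-cokernels in the sense
of pointed groupoid enrichment. -/
theorem isCokernel_iff {A B Q : C} {f : A ⟶ B} {c : B ⟶ Q} {n : (zeroIdeal Z hZ).Null A Q}
    {α : f ≫ c ≅ (zeroIdeal Z hZ).ι.obj n} :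
    (zeroIdeal Z hZ).IsCokernel f c n α ↔ Gpd.IsCokernel f c (α.hom ≫ toZero hZ n) := by
  have h₂ {X : C} (x y : Q ⟶ X) (l : c ≫ x ⟶ c ≫ y) :
      (zeroIdeal Z hZ).IsNull (((zeroIdeal Z hZ).νr n x).inv ≫ α.inv ▷ x ≫ (α_ f c x).hom ≫
        f ◁ l ≫ (α_ f c y).inv ≫ α.hom ▷ y ≫ ((zeroIdeal Z hZ).νr n y).hom) ↔
      f ◁ l ≫ (α_ f c y).inv ≫ (α.hom ≫ toZero hZ n) ▷₀ y =
        (α_ f c x).inv ≫ (α.hom ≫ toZero hZ n) ▷₀ x := by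
    rw [isNull_iff, ← whiskerRightIso_inv, ← Iso.symm_inv (α_ f c x)]
    simp only [Category.assoc, νr_hom_toZero, Iso.inv_comp_eq, comp_whiskerRightZero,
      whiskerRightIso_hom, Iso.symm_hom]
  have h₁ {X : C} (z : B ⟶ X) (m : (zeroIdeal Z hZ).Null A X) (β : f ≫ z ≅ _) (u : Q ⟶ X)
      (γ : z ⟶ c ≫ u) : (zeroIdeal Z hZ).IsNullIso (β.inv ≫ f ◁ γ ≫ (α_ f c u).inv ≫
        α.hom ▷ u ≫ ((zeroIdeal Z hZ).νr n u).hom) ↔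
      f ◁ γ ≫ (α_ f c u).inv ≫ (α.hom ≫ toZero hZ n) ▷₀ u = β.hom ≫ toZero hZ m := by
    rw [isNullIso_iff]
    simp only [Category.assoc, νr_hom_toZero, Iso.inv_comp_eq, comp_whiskerRightZero]
  rw [Gpd.isCokernel_iff]
  refine ⟨fun h => ⟨fun {X} z β => ?_, fun x y l hl => h.desc₂ x y l ((h₂ x y l).2 hl)⟩,
    fun h => ⟨fun {X} z m β => ?_, fun x y l hl => h.2 x y l ((h₂ x y l).1 hl)⟩⟩
  · obtain ⟨m, β', rfl⟩ := exists_iso_toZero hZ β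
    obtain ⟨u, γ, hγ⟩ := h.desc z m β'
    exact ⟨u, γ.hom, (h₁ z m β' u γ.hom).1 hγ⟩
  · obtain ⟨u, γ, hγ⟩ := h.1 z (β.hom ≫ toZero hZ m)
    exact ⟨u, asIso γ, (h₁ z m β u γ).2 hγ⟩

theorem isZeroFaithful_of_isKernelMorphism {K A : C} {k : K ⟶ A}
    (hk : (zeroIdeal Z hZ).IsKernelMorphism k) : IsZeroFaithful k :=
  let ⟨_, _, _, _, h⟩ := hk
  ((isKernel_iff hZ).1 h).isZeroFaithful

theorem isZeroCofaithful_of_isCokernelMorphism {B Q : C} {c : B ⟶ Q}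
    (hc : (zeroIdeal Z hZ).IsCokernelMorphism c) : IsZeroCofaithful c :=
  let ⟨_, _, _, _, h⟩ := hc
  ((isCokernel_iff hZ).1 h).isZeroCofaithful

theorem isKernelMorphism_of_isKernel {A B K : C} {f : A ⟶ B} {k : K ⟶ A} {κ : k ≫ f ⟶ zero K B}
    (h : Gpd.IsKernel f k κ) : (zeroIdeal Z hZ).IsKernelMorphism k := by
  obtain ⟨n, α, rfl⟩ := exists_iso_toZero hZ κ
  exact ⟨B, f, n, α, (isKernel_iff hZ).2 h⟩

theorem isCokernelMorphism_of_isCokernel {A B Q : C} {f : A ⟶ B} {c : B ⟶ Q}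
    {κ : f ≫ c ⟶ zero A Q} (h : Gpd.IsCokernel f c κ) :
    (zeroIdeal Z hZ).IsCokernelMorphism c := by
  obtain ⟨n, α, rfl⟩ := exists_iso_toZero hZ κ
  exact ⟨A, f, n, α, (isCokernel_iff hZ).2 h⟩

/-- A 2-cell between null morphisms corresponds to a loop on the zero morphism, and it is null exactly
when that loop is trivial; so 0-faithful morphisms reflect null 2-cells. -/
theorem reflectsNullTwoCells {K A : C} {k : K ⟶ A} (hk : IsZeroFaithful k) :
    (zeroIdeal Z hZ).ReflectsNullTwoCells k := by
  intro D s s' μ hμ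
  rw [isNull_iff] at hμ ⊢
  simp only [Category.assoc, νr_hom_toZero] at hμ
  rw [Iso.inv_comp_eq, νr_hom_toZero, ← comp_whiskerRightZero] at hμ
  have h := hk (inv (toZero hZ s) ≫ μ ≫ toZero hZ s') (by
    rw [post_eq_id_iff, comp_whiskerRightZero, hμ, ← comp_whiskerRightZero, IsIso.inv_hom_id])
  rwa [IsIso.inv_comp_eq, Category.comp_id] at h

theorem coreflectsNullTwoCells {B Q : C} {c : B ⟶ Q} (hc : IsZeroCofaithful c) :
    (zeroIdeal Z hZ).CoreflectsNullTwoCells c := by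
  intro D s s' μ hμ
  rw [isNull_iff] at hμ ⊢
  simp only [Category.assoc, νl_hom_toZero] at hμ
  rw [Iso.inv_comp_eq, νl_hom_toZero, ← whiskerLeftZero_comp] at hμ
  have h := hc (inv (toZero hZ s) ≫ μ ≫ toZero hZ s') (by
    rw [pre_eq_id_iff, whiskerLeftZero_comp, hμ, ← whiskerLeftZero_comp, IsIso.inv_hom_id])
  rwa [IsIso.inv_comp_eq, Category.comp_id] at h

theorem weaklyReflectsNull {A B K : C} {f : A ⟶ B} {k : K ⟶ A} {n : (zeroIdeal Z hZ).Null K B}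
    {α : k ≫ f ≅ (zeroIdeal Z hZ).ι.obj n} (h : (zeroIdeal Z hZ).IsKernel f k n α) :
    (zeroIdeal Z hZ).WeaklyReflectsNull f k n α := by
  rw [isKernel_iff, Gpd.isKernel_iff] at h
  intro D s m δ hδ
  rw [isNullIso_iff, ← whiskerRightIso_inv] at hδ
  simp only [Category.assoc, νl_hom_toZero, Iso.inv_comp_eq, νr_hom_toZero,
    ← whiskerLeftZero_comp, whiskerRightIso_hom] at hδ
  -- The 2-cell `δ` from `s ≫ k` to a null morphism, seen as a 2-cell `s ≫ k ⟶ 0 ≫ k`, lifts to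
  -- a 2-cell `s ⟶ 0`.
  obtain ⟨μ, hμ, -⟩ := h.2 s (zero D K)
    (δ.hom ≫ toZero hZ m ≫ eqToHom (zero_comp D k).symm) (by
      rw [hδ]
      simp [whiskerLeftZero, whiskerRightZero, zero_whisker, Strict.associator_eqToIso])
  obtain ⟨p, ψ, hψ⟩ := exists_iso_toZero hZ μ
  refine ⟨p, ψ, ?_⟩
  rw [isNullIso_iff]
  simp only [Category.assoc, νr_hom_toZero, Iso.inv_comp_eq]
  rw [← comp_whiskerRightZero, hψ, whiskerRightZero, hμ]
  simp

theorem weaklyCoreflectsNull {A B Q : C} {f : A ⟶ B} {c : B ⟶ Q}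
    {n : (zeroIdeal Z hZ).Null A Q} {α : f ≫ c ≅ (zeroIdeal Z hZ).ι.obj n}
    (h : (zeroIdeal Z hZ).IsCokernel f c n α) :
    (zeroIdeal Z hZ).WeaklyCoreflectsNull f c n α := by
  rw [isCokernel_iff, Gpd.isCokernel_iff] at h
  intro D s m δ hδ
  rw [isNullIso_iff, ← whiskerLeftIso_inv] at hδ
  simp only [Category.assoc, νr_hom_toZero, Iso.inv_comp_eq, νl_hom_toZero,
    ← comp_whiskerRightZero, whiskerLeftIso_hom] at hδ
  obtain ⟨μ, hμ, -⟩ := h.2 s (zero Q D)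
    (δ.hom ≫ toZero hZ m ≫ eqToHom (comp_zero c D).symm) (by
      rw [hδ]
      simp [whiskerLeftZero, whiskerRightZero, whisker_zero, Strict.associator_eqToIso])
  obtain ⟨p, ψ, hψ⟩ := exists_iso_toZero hZ μ
  refine ⟨p, ψ, ?_⟩
  rw [isNullIso_iff]
  simp only [Category.assoc, νl_hom_toZero, Iso.inv_comp_eq]
  rw [← whiskerLeftZero_comp, hψ, whiskerLeftZero, hμ]
  simp

end zeroIdeal

end ZeroIdeal

/-! ### Weak Puppe 2-exactness -/

theorem Gpd.IsTwoPuppeExact.isWeaklyPuppeExact {C : Type u} [Bicategory.{w, v} C]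
    [Bicategory.Strict C] [IsLocallyGroupoid C] [PointedHoms C] (hC : IsTwoPuppeExact C) {Z : C}
    (hZ : IsBizero Z) : IsWeaklyPuppeExact Z := by
  refine ⟨hZ, ?_, ?_, ⟨?_, ?_, ?_, ?_⟩, ?_, ?_, ?_⟩
  · intro A B f
    obtain ⟨K, k, κ, h⟩ := hC.hasKernels f
    obtain ⟨n, α, rfl⟩ := zeroIdeal.exists_iso_toZero hZ κ
    exact ⟨K, k, n, α, (zeroIdeal.isKernel_iff hZ).2 h⟩
  · intro A B f
    obtain ⟨Q, c, κ, h⟩ := hC.hasCokernels f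
    obtain ⟨n, α, rfl⟩ := zeroIdeal.exists_iso_toZero hZ κ
    exact ⟨Q, c, n, α, (zeroIdeal.isCokernel_iff hZ).2 h⟩
  · exact fun f k n α h => zeroIdeal.weaklyReflectsNull hZ h
  · exact fun k hk =>
      zeroIdeal.reflectsNullTwoCells hZ (zeroIdeal.isZeroFaithful_of_isKernelMorphism hZ hk)
  · exact fun f c n α h => zeroIdeal.weaklyCoreflectsNull hZ h
  · exact fun c hc =>
      zeroIdeal.coreflectsNullTwoCells hZ (zeroIdeal.isZeroCofaithful_of_isCokernelMorphism hZ hc)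
  · exact fun m hm c n γ h => (zeroIdeal.isKernel_iff hZ).2 <| hC.kernel_of_cokernel m
      (zeroIdeal.isZeroFaithful_of_isKernelMorphism hZ hm) c _ ((zeroIdeal.isCokernel_iff hZ).1 h)
  · exact fun e he k n γ h => (zeroIdeal.isCokernel_iff hZ).2 <| hC.cokernel_of_kernel e
      (zeroIdeal.isZeroCofaithful_of_isCokernelMorphism hZ he) k _ ((zeroIdeal.isKernel_iff hZ).1 h)
  · intro A B f
    obtain ⟨Q, K, c, m, κ, e, hm, he, ⟨φ⟩⟩ := hC.exists_factorization f
    obtain ⟨L, k, κ', hk⟩ := hC.hasKernels e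
    exact ⟨K, e, m,
      zeroIdeal.isCokernelMorphism_of_isCokernel hZ (hC.cokernel_of_kernel e he k κ' hk),
      zeroIdeal.isKernelMorphism_of_isKernel hZ hm, ⟨asIso φ⟩⟩

end TwoExact

theorem mainTheorem6 (C : Type u) [Bicategory.{w, v} C] [Bicategory.Strict C] [IsLocallyGroupoid C]
    [TwoExact.PointedHoms C] :
    (TwoExact.Gpd.IsTwoPuppeExact C →
      TwoExact.IsTwoPointed C ∧
        ∀ Z : C, TwoExact.IsBizero Z → TwoExact.IsWeaklyPuppeExact Z) ∧
    (TwoExact.Gpd.IsTwoAbelian C →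
      TwoExact.IsTwoPointed C ∧
        ∀ Z : C, TwoExact.IsBizero Z → TwoExact.IsWeaklyPuppeExact Z) := by
  have h (hC : TwoExact.Gpd.IsTwoPuppeExact C) : TwoExact.IsTwoPointed C ∧
      ∀ Z : C, TwoExact.IsBizero Z → TwoExact.IsWeaklyPuppeExact Z :=
    ⟨hC.exists_zero, fun _ hZ => hC.isWeaklyPuppeExact hZ⟩
  exact ⟨h, fun hC => h hC.toIsTwoPuppeExact⟩
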